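/- For $\epsilon,\epsilon'\in\mathbb{R}$, $\zeta\in\mathbb{C}$ and $\tau$ in the upper half plane $\mathbb{H}$, let $$\theta\begin{bmatrix}\epsilon\\ \epsilon'\end{bmatrix}(\zeta,\tau)=\sum_{n\in\mathbb{Z}}\exp\left(2\pi i\left[\tfrac12\left(n+\tfrac{\epsilon}{2}\right)^2\tau+\left(n+\tfrac{\epsilon}{2}\right)\left(\zeta+\tfrac{\epsilon'}{2}\right)\right]\right),\qquad \theta'\begin{bmatrix}\epsilon\\ \epsilon'\end{bmatrix}(0,\tau)=\left.\frac{\partial}{\partial\zeta}\theta\begin{bmatrix}\epsilon\\ \epsilon'\end{bmatrix}(\zeta,\tau)\right|_{\zeta=0}.$$ Then, for every $\tau\in\mathbb{H}$, the values $\theta\begin{bmatrix}1\\ 1/4\end{bmatrix}(0,\tau)$ and $\theta\begin{bmatrix}1\\ 3/4\end{bmatrix}(0,\tau)$ are nonzero, and $$\theta^4\begin{bmatrix}1\\ 1/4\end{bmatrix}(0,\tau)\cdot\frac{\theta'\begin{bmatrix}1\\ 1/4\end{bmatrix}(0,\tau)}{\theta\begin{bmatrix}1\\ 1/4\end{bmatrix}(0,\tau)}-\theta^4\begin{bmatrix}1\\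 3/4\end{bmatrix}(0,\tau)\cdot\frac{\theta'\begin{bmatrix}1\\ 3/4\end{bmatrix}(0,\tau)}{\theta\begin{bmatrix}1\\ 3/4\end{bmatrix}(0,\tau)}$$ $$=-2\pi\,\theta^2\begin{bmatrix}0\\ 0\end{bmatrix}(0,4\tau)\,\theta\begin{bmatrix}1\\ 0\end{bmatrix}(0,4\tau)\,\theta\begin{bmatrix}0\\ 1\end{bmatrix}(0,4\tau)\left\{\theta^2\begin{bmatrix}0\\ 0\end{bmatrix}(0,4\tau)+3\,\theta^2\begin{bmatrix}1\\ 0\end{bmatrix}(0,4\tau)\right\}.$$ -/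

import Mathlib

/-- The theta function with characteristics
`θ[ε; ε'](ζ, τ) = ∑_{n ∈ ℤ} exp (2πi ((1/2) (n + ε/2)² τ + (n + ε/2) (ζ + ε'/2)))`. -/
noncomputable def thetaChar (ε ε' : ℝ) (ζ : ℂ) (τ : UpperHalfPlane) : ℂ :=
  ∑' n : ℤ, Complex.exp (2 * Real.pi * Complex.I *
    ((1 / 2) * ((n : ℂ) + (ε : ℂ) / 2) ^ 2 * (τ : ℂ) +
      ((n : ℂ) + (ε : ℂ) / 2) * (ζ + (ε' : ℂ) / 2)))

/-- The theta constant `θ[ε; ε'](0, τ)`. -/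
noncomputable def thetaConst (ε ε' : ℝ) (τ : UpperHalfPlane) : ℂ :=
  thetaChar ε ε' 0 τ

/-- The derivative `θ'[ε; ε'](0, τ)` of `ζ ↦ θ[ε; ε'](ζ, τ)` at `ζ = 0`. -/
noncomputable def thetaDerivConst (ε ε' : ℝ) (τ : UpperHalfPlane) : ℂ :=
  deriv (fun ζ : ℂ => thetaChar ε ε' ζ τ) 0

/-- The point `4τ` of the upper half plane. -/
noncomputable def fourMul (τ : UpperHalfPlane) : UpperHalfPlane :=
  ⟨4 * (τ : ℂ), by simpa using τ.im_pos⟩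

/-! Write `θ₂`, `θ₃` for `theta₂`, `jacobiTheta₂`. The two characteristics give `θ₂` at `1/8` and at
`3/8 = 1/2 - 1/8`, so the left side is a quarter of the derivative at `z = 1/8` of `θ₂(z)⁴ + θ₂(1/2
- z)⁴`. Two rounds of duplication formulas (`theta₂_sq`, `jacobiTheta₂_sq`) make this sum a
combination of `θ₂(4z, 4τ)` and `θ₃(4z, 4τ)` with coefficients free of `z` (`theta₂_pow_four_add`).
At `4z = 1/2` the derivative of `θ₃` vanishes, and that of `θ₂` is given by Jacobi's derivative
formula (`hasDerivAt_theta₂_half`). The latter rests on the triple product, obtained as a limit of a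
finite identity, on its derivative at a zero, and on Euler's identity. The triple product also gives
the nonvanishing (`theta₂_ne_zero`). -/

open Filter Topology

/-! ### Infinite q-products and Euler's identity. -/

/-- The finite product `∏_{k < N} (1 + x p^k)`. -/
noncomputable def qProd (x p : ℂ) (N : ℕ) : ℂ := ∏ k ∈ Finset.range N, (1 + x * p ^ k)

/-- The infinite product `∏_k (1 + x p^k)`. -/
noncomputable def qProdInf (x p : ℂ) : ℂ := ∏' k : ℕ, (1 + x * p ^ k)

lemma qProd_succ (x p : ℂ) (N : ℕ) : qProd x p (N + 1) = qProd x p N * (1 + x * p ^ N) :=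
  Finset.prod_range_succ _ _

lemma qProd_succ' (x p : ℂ) (N : ℕ) : qProd x p (N + 1) = (1 + x) * qProd (x * p) p N := by
  rw [qProd, Finset.prod_range_succ', mul_comm]
  simp [qProd, pow_succ', mul_assoc]

lemma summable_norm_mul_pow (x : ℂ) {p : ℂ} (hp : ‖p‖ < 1) : Summable fun k : ℕ => ‖x * p ^ k‖ := by
  simpa [norm_mul, norm_pow] using (summable_geometric_of_lt_one (norm_nonneg p) hp).mul_left ‖x‖

lemma tendsto_qProd (x : ℂ) {p : ℂ} (hp : ‖p‖ < 1) :
    Tendsto (qProd x p) atTop (𝓝 (qProdInf x p)) :=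
  (multipliable_one_add_of_summable (summable_norm_mul_pow x hp)).tendsto_prod_tprod_nat

lemma qProdInf_ne_zero {x p : ℂ} (hp : ‖p‖ < 1) (h : ∀ k : ℕ, 1 + x * p ^ k ≠ 0) :
    qProdInf x p ≠ 0 :=
  tprod_one_add_ne_zero_of_summable h (summable_norm_mul_pow x hp)

lemma qProdInf_eq_one_add_mul (x : ℂ) {p : ℂ} (hp : ‖p‖ < 1) :
    qProdInf x p = (1 + x) * qProdInf (x * p) p := by
  refine tendsto_nhds_unique ((tendsto_qProd x hp).comp (tendsto_add_atTop_nat 1)) ?_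
  simpa only [Function.comp_def, qProd_succ'] using (tendsto_qProd (x * p) hp).const_mul (1 + x)

lemma one_add_ne_zero_of_norm_lt {z : ℂ} (h : ‖z‖ < 1) : 1 + z ≠ 0 := by
  intro h0
  rw [eq_neg_of_add_eq_zero_right h0] at h
  simp at h

lemma norm_mul_pow_lt_one {x p : ℂ} (hx : ‖x‖ < 1) (hp : ‖p‖ < 1) (k : ℕ) : ‖x * p ^ k‖ < 1 := by
  rw [norm_mul, norm_pow]
  exact (mul_le_of_le_one_right (norm_nonneg _) (pow_le_one₀ (norm_nonneg _) hp.le)).trans_lt hx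

lemma qProdInf_ne_zero_of_norm_lt {x p : ℂ} (hx : ‖x‖ < 1) (hp : ‖p‖ < 1) : qProdInf x p ≠ 0 :=
  qProdInf_ne_zero hp fun k => one_add_ne_zero_of_norm_lt (norm_mul_pow_lt_one hx hp k)

lemma qProd_ne_zero_of_norm_lt {x p : ℂ} (hx : ‖x‖ < 1) (hp : ‖p‖ < 1) (N : ℕ) :
    qProd x p N ≠ 0 :=
  Finset.prod_ne_zero_iff.2 fun k _ => one_add_ne_zero_of_norm_lt (norm_mul_pow_lt_one hx hp k)

/-- Euler's identity `∏ (1 + q^{2k}) (1 + q^{2k-1}) (1 - q^{2k-1}) = 1`. -/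
lemma qProdInf_euler {q : ℂ} (hq : ‖q‖ < 1) :
    qProdInf (q ^ 2) (q ^ 2) * qProdInf q (q ^ 2) * qProdInf (-q) (q ^ 2) = 1 := by
  have hp : ‖q ^ 2‖ < 1 := by rw [norm_pow]; exact pow_lt_one₀ (norm_nonneg _) hq two_ne_zero
  -- By differences of squares the left side becomes the product of `1 - q^(4k)` and `1 - q^(4k-2)`,
  -- that is, of all `1 - q^(2j)` with `j ≤ 2N`.
  have key (N : ℕ) : qProd (q ^ 2) (q ^ 2) N * qProd q (q ^ 2) N * qProd (-q) (q ^ 2) N *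
      qProd (-q ^ 2) (q ^ 2) N = qProd (-q ^ 2) (q ^ 2) (2 * N) := by
    induction N with
    | zero => simp [qProd]
    | succ N ih =>
      rw [show 2 * (N + 1) = 2 * N + 1 + 1 by ring]
      simp only [qProd_succ]
      rw [← ih]
      ring
  have h0 : qProdInf (-q ^ 2) (q ^ 2) ≠ 0 := qProdInf_ne_zero_of_norm_lt (by simpa using hp) hp
  refine mul_right_cancel₀ h0 ?_
  rw [one_mul]
  refine tendsto_nhds_unique ((((tendsto_qProd _ hp).mul (tendsto_qProd _ hp)).mul
    (tendsto_qProd _ hp)).mul (tendsto_qProd _ hp)) ?_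
  simp only [key]
  exact (tendsto_qProd _ hp).comp (tendsto_id.const_mul_atTop' two_pos)

/-! ### Jacobi's triple product and its derivative. -/

/-- The reciprocal of `∏_{1 ≤ k ≤ m} (1 - p^k)`, extended by `0` to negative `m`. -/
noncomputable def qFactInv (p : ℂ) (m : ℤ) : ℂ := if 0 ≤ m then (qProd (-p) p m.toNat)⁻¹ else 0

/-- Extension by `0` is consistent because `1 - p^0 = 0`; the recurrence for `qCoeff` then needs no
boundary cases. -/
lemma qFactInv_sub_one {p : ℂ} (hp : ‖p‖ < 1) (m : ℤ) :
    qFactInv p (m - 1) = (1 - p ^ m) * qFactInv p m := by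
  rcases lt_trichotomy m 0 with h | rfl | h
  · rw [qFactInv, qFactInv, if_neg (by omega), if_neg (by omega), mul_zero]
  · simp [qFactInv]
  · obtain ⟨n, rfl⟩ : ∃ n : ℕ, m = n + 1 := ⟨(m - 1).toNat, by omega⟩
    have h1 : qProd (-p) p (n + 1) ≠ 0 := qProd_ne_zero_of_norm_lt (by simpa using hp) hp _
    have h2 : ((n : ℤ) + 1).toNat = n + 1 := by omega
    rw [qFactInv, qFactInv, if_pos (by omega), if_pos (by omega), h2, add_sub_cancel_right,
      Int.toNat_natCast]
    rw [qProd_succ] at h1 ⊢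
    have h3 := left_ne_zero_of_mul h1
    have h4 := right_ne_zero_of_mul h1
    rw [mul_inv, mul_comm (1 - _)]
    have h5 : (1 - p ^ ((n : ℤ) + 1)) = 1 + -p * p ^ n := by
      rw [← Nat.cast_succ, zpow_natCast, Nat.succ_eq_add_one, pow_succ]; ring
    rw [h5, mul_assoc, inv_mul_cancel₀ h4, mul_one]

/-- The coefficient `(p)_{2N} / ((p)_{N-n} (p)_{N+n})` of the finite triple product. -/
noncomputable def qCoeff (p : ℂ) (N : ℕ) (n : ℤ) : ℂ :=
  qProd (-p) p (2 * N) * (qFactInv p (N - n) * qFactInv p (N + n))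

lemma qCoeff_eq_zero (p : ℂ) {N : ℕ} {n : ℤ} (h : n ∉ Finset.Icc (-(N : ℤ)) N) :
    qCoeff p N n = 0 := by
  rw [Finset.mem_Icc, not_and_or] at h
  rcases h with h | h
  · simp [qCoeff, qFactInv, show ¬ (0 ≤ (N : ℤ) + n) by omega]
  · rw [qCoeff, qFactInv, if_neg (by omega), zero_mul, mul_zero]

/-- This compares coefficients of `w^n` when the product is multiplied by `(1 + w q^(2N+1)) (1 + w⁻¹
q^(2N+1))`. Writing all reciprocals in terms of those at `N + 1 ± n` leaves a polynomial identity.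
-/
lemma qCoeff_succ {q : ℂ} (hq : ‖q‖ < 1) (hq0 : q ≠ 0) (N : ℕ) (n : ℤ) :
    qCoeff (q ^ 2) (N + 1) n = (1 + (q ^ (2 * N + 1)) ^ 2) * qCoeff (q ^ 2) N n +
      q ^ (2 * ((N : ℤ) + 1 - n)) * qCoeff (q ^ 2) N (n - 1) +
      q ^ (2 * ((N : ℤ) + 1 + n)) * qCoeff (q ^ 2) N (n + 1) := by
  have hp : ‖q ^ 2‖ < 1 := by rw [norm_pow]; exact pow_lt_one₀ (norm_nonneg _) hq two_ne_zero
  have hz (m : ℤ) : (q ^ 2) ^ m = q ^ (2 * m) := by rw [zpow_mul]; norm_cast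
  have e1 := qFactInv_sub_one hp ((N : ℤ) + 1 - n)
  have e2 := qFactInv_sub_one hp ((N : ℤ) + 1 + n)
  have e3 := qFactInv_sub_one hp ((N : ℤ) - n)
  have e4 := qFactInv_sub_one hp ((N : ℤ) + n)
  rw [show (N : ℤ) + 1 - n - 1 = N - n by ring] at e1
  rw [show (N : ℤ) + 1 + n - 1 = N + n by ring] at e2
  rw [e1] at e3
  rw [e2] at e4
  simp only [qCoeff]
  push_cast
  rw [show (N : ℤ) - (n - 1) = N + 1 - n by ring, show (N : ℤ) + (n + 1) = N + 1 + n by ring,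
    show (N : ℤ) + (n - 1) = N + n - 1 by ring, show (N : ℤ) - (n + 1) = N - n - 1 by ring,
    e4, e3, e1, e2, hz, hz, hz, hz, show 2 * (N + 1) = 2 * N + 1 + 1 by ring, qProd_succ, qProd_succ]
  have x1 : q ^ (2 * ((N : ℤ) + 1 - n)) = q ^ 2 * q ^ (2 * ((N : ℤ) - n)) := by
    rw [← zpow_natCast, ← zpow_add₀ hq0]; congr 1; push_cast; ring
  have x2 : q ^ (2 * ((N : ℤ) + 1 + n)) = q ^ 2 * q ^ (2 * ((N : ℤ) + n)) := by
    rw [← zpow_natCast, ← zpow_add₀ hq0]; congr 1; push_cast; ring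
  have x3 : q ^ (2 * ((N : ℤ) + n)) * q ^ (2 * ((N : ℤ) - n)) = q ^ (4 * N) := by
    rw [← zpow_natCast, ← zpow_add₀ hq0]; congr 1; push_cast; ring
  rw [x1, x2]
  have x4 : -q ^ 2 * (q ^ 2) ^ (2 * N) = - q ^ 2 * q ^ (4 * N) := by ring
  have x5 : -q ^ 2 * (q ^ 2) ^ (2 * N + 1) = - q ^ 4 * q ^ (4 * N) := by ring
  have x6 : (q ^ (2 * N + 1)) ^ 2 = q ^ 2 * q ^ (4 * N) := by ring
  rw [x4, x5, x6, ← x3]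
  ring

/-- The finite form of Jacobi's triple product. -/
lemma hasSum_finite_triple_product {q : ℂ} (hq : ‖q‖ < 1) (hq0 : q ≠ 0) {w : ℂ} (hw : w ≠ 0)
    (N : ℕ) : HasSum (fun n : ℤ => qCoeff (q ^ 2) N n * (q ^ (n ^ 2) * w ^ n))
      (qProd (w * q) (q ^ 2) N * qProd (w⁻¹ * q) (q ^ 2) N) := by
  induction N with
  | zero =>
    convert hasSum_single (0 : ℤ) ?_ using 1
    · simp [qCoeff, qProd, qFactInv]
    · intro n hn
      rw [qCoeff_eq_zero _ (by simpa using hn), zero_mul]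
  | succ N ih =>
    have h1 := ih.mul_left (1 + (q ^ (2 * N + 1)) ^ 2)
    have h2 := (((Equiv.subRight (1 : ℤ)).hasSum_iff).2 ih).mul_left (w * q ^ (2 * N + 1))
    have h3 := (((Equiv.addRight (1 : ℤ)).hasSum_iff).2 ih).mul_left (w⁻¹ * q ^ (2 * N + 1))
    have hw' : w * w⁻¹ = 1 := mul_inv_cancel₀ hw
    have hP : qProd (w * q) (q ^ 2) (N + 1) * qProd (w⁻¹ * q) (q ^ 2) (N + 1) =
        (1 + (q ^ (2 * N + 1)) ^ 2) * (qProd (w * q) (q ^ 2) N * qProd (w⁻¹ * q) (q ^ 2) N) +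
          w * q ^ (2 * N + 1) * (qProd (w * q) (q ^ 2) N * qProd (w⁻¹ * q) (q ^ 2) N) +
          w⁻¹ * q ^ (2 * N + 1) * (qProd (w * q) (q ^ 2) N * qProd (w⁻¹ * q) (q ^ 2) N) := by
      rw [qProd_succ, qProd_succ]
      linear_combination (qProd (w * q) (q ^ 2) N * qProd (w⁻¹ * q) (q ^ 2) N *
        (q ^ (2 * N + 1)) ^ 2) * hw'
    rw [hP]
    refine HasSum.congr_fun ((h1.add h2).add h3) fun n => ?_
    simp only [Function.comp_apply, Equiv.subRight_apply, Equiv.coe_addRight]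
    rw [qCoeff_succ hq hq0, zpow_add_one₀ hw, zpow_sub_one₀ hw]
    have y1 : q ^ ((n - 1) ^ 2) * q ^ (2 * N + 1) = q ^ (n ^ 2) * q ^ (2 * ((N : ℤ) + 1 - n)) := by
      rw [← zpow_natCast, ← zpow_add₀ hq0, ← zpow_add₀ hq0]; congr 1; push_cast; ring
    have y2 : q ^ ((n + 1) ^ 2) * q ^ (2 * N + 1) = q ^ (n ^ 2) * q ^ (2 * ((N : ℤ) + 1 + n)) := by
      rw [← zpow_natCast, ← zpow_add₀ hq0, ← zpow_add₀ hq0]; congr 1; push_cast; ring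
    linear_combination (-w ^ n * w * w⁻¹ * qCoeff (q ^ 2) N (n - 1)) * y1 -
      (w ^ n * w * w⁻¹ * qCoeff (q ^ 2) N (n + 1)) * y2 - (q ^ (n ^ 2) * w ^ n *
        (q ^ (2 * ((N : ℤ) + 1 - n)) * qCoeff (q ^ 2) N (n - 1) +
        q ^ (2 * ((N : ℤ) + 1 + n)) * qCoeff (q ^ 2) N (n + 1))) * hw'

lemma tendsto_qFactInv {p : ℂ} (hp : ‖p‖ < 1) :
    Tendsto (qFactInv p) atTop (𝓝 (qProdInf (-p) p)⁻¹) := by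
  have h0 : qProdInf (-p) p ≠ 0 := qProdInf_ne_zero_of_norm_lt (by simpa using hp) hp
  have h1 : Tendsto Int.toNat atTop atTop :=
    tendsto_atTop_atTop.2 fun b => ⟨b, fun a ha => by omega⟩
  refine (((tendsto_qProd (-p) hp).inv₀ h0).comp h1).congr' ?_
  filter_upwards [eventually_ge_atTop 0] with m hm
  simp [qFactInv, hm]

lemma exists_norm_qFactInv_le {p : ℂ} (hp : ‖p‖ < 1) : ∃ C, ∀ m, ‖qFactInv p m‖ ≤ C := by
  have h0 : qProdInf (-p) p ≠ 0 := qProdInf_ne_zero_of_norm_lt (by simpa using hp) hp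
  obtain ⟨C, hC⟩ := ((tendsto_qProd (-p) hp).inv₀ h0).norm.bddAbove_range
  refine ⟨max C 0, fun m => ?_⟩
  unfold qFactInv
  split_ifs
  · exact (hC ⟨m.toNat, rfl⟩).trans (le_max_left _ _)
  · simp

lemma exists_norm_qCoeff_le {p : ℂ} (hp : ‖p‖ < 1) : ∃ C, ∀ N n, ‖qCoeff p N n‖ ≤ C := by
  obtain ⟨C, hC⟩ := exists_norm_qFactInv_le hp
  obtain ⟨D, hD⟩ := (tendsto_qProd (-p) hp).norm.bddAbove_range
  have hC0 := (norm_nonneg _).trans (hC 0)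
  refine ⟨D * (C * C), fun N n => ?_⟩
  rw [qCoeff, norm_mul, norm_mul]
  have hD' : ‖qProd (-p) p (2 * N)‖ ≤ D := hD ⟨2 * N, rfl⟩
  gcongr
  · exact (norm_nonneg _).trans hD'
  · exact hC _
  · exact hC _

lemma tendsto_qCoeff {p : ℂ} (hp : ‖p‖ < 1) (n : ℤ) :
    Tendsto (fun N => qCoeff p N n) atTop (𝓝 (qProdInf (-p) p)⁻¹) := by
  have h0 : qProdInf (-p) p ≠ 0 := qProdInf_ne_zero_of_norm_lt (by simpa using hp) hp
  have h1 : Tendsto (fun N : ℕ => (N : ℤ) - n) atTop atTop :=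
    tendsto_atTop_add_const_right _ (-n) tendsto_natCast_atTop_atTop
  have h2 : Tendsto (fun N : ℕ => (N : ℤ) + n) atTop atTop :=
    tendsto_atTop_add_const_right _ n tendsto_natCast_atTop_atTop
  have h3 := ((tendsto_qProd (-p) hp).comp (tendsto_id.const_mul_atTop' two_pos)).mul
    (((tendsto_qFactInv hp).comp h1).mul ((tendsto_qFactInv hp).comp h2))
  rwa [mul_inv_cancel_left₀ h0] at h3

/-- Dominated convergence: the coefficients are uniformly bounded and each has the same limit. -/
lemma tendsto_tsum_qCoeff_mul {p : ℂ} (hp : ‖p‖ < 1) {u : ℤ → ℂ} (hu : Summable u) :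
    Tendsto (fun N => ∑' n, qCoeff p N n * u n) atTop (𝓝 ((qProdInf (-p) p)⁻¹ * ∑' n, u n)) := by
  obtain ⟨C, hC⟩ := exists_norm_qCoeff_le hp
  rw [← tsum_mul_left]
  refine tendsto_tsum_of_dominated_convergence (bound := fun n => C * ‖u n‖)
    (hu.norm.mul_left C) (fun n => (tendsto_qCoeff hp n).mul_const _) (Eventually.of_forall ?_)
  intro N n
  rw [norm_mul]
  exact mul_le_mul_of_nonneg_right (hC N n) (norm_nonneg _)

/-- Jacobi's triple product. -/
theorem tsum_triple_product {q : ℂ} (hq : ‖q‖ < 1) (hq0 : q ≠ 0) {w : ℂ} (hw : w ≠ 0)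
    (hs : Summable fun n : ℤ => q ^ (n ^ 2) * w ^ n) :
    ∑' n : ℤ, q ^ (n ^ 2) * w ^ n =
      qProdInf (-q ^ 2) (q ^ 2) * (qProdInf (w * q) (q ^ 2) * qProdInf (w⁻¹ * q) (q ^ 2)) := by
  have hp : ‖q ^ 2‖ < 1 := by rw [norm_pow]; exact pow_lt_one₀ (norm_nonneg _) hq two_ne_zero
  have h0 : qProdInf (-q ^ 2) (q ^ 2) ≠ 0 := qProdInf_ne_zero_of_norm_lt (by simpa using hp) hp
  have h1 := tendsto_tsum_qCoeff_mul hp hs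
  simp only [(hasSum_finite_triple_product hq hq0 hw _).tsum_eq] at h1
  have h2 := tendsto_nhds_unique h1 ((tendsto_qProd (w * q) hp).mul (tendsto_qProd (w⁻¹ * q) hp))
  rw [← h2, mul_inv_cancel_left₀ h0]

/-- Apply `w d/dw` to the finite triple product at `w = -q`. The factor `1 + w⁻¹ q`, split off in
`hsum`, vanishes there, so only the term differentiating it survives. -/
lemma tsum_mul_finite_triple_product_neg {q : ℂ} (hq : ‖q‖ < 1) (hq0 : q ≠ 0) (N : ℕ) :
    ∑' n : ℤ, qCoeff (q ^ 2) (N + 1) n * (n * (q ^ (n ^ 2) * (-q) ^ n)) =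
      qProd (-q ^ 2) (q ^ 2) (N + 1) * qProd (-q ^ 2) (q ^ 2) N := by
  have hq' : -q ≠ 0 := neg_ne_zero.2 hq0
  let s := Finset.Icc (-((N + 1 : ℕ) : ℤ)) ((N + 1 : ℕ) : ℤ)
  have hsum (w : ℂ) (hw : w ≠ 0) : ∑ n ∈ s, qCoeff (q ^ 2) (N + 1) n * (q ^ (n ^ 2) * w ^ n) =
      (qProd (w * q) (q ^ 2) (N + 1) * qProd (w⁻¹ * q * q ^ 2) (q ^ 2) N) * (1 + w⁻¹ * q) := by
    rw [← tsum_eq_sum (L := .unconditional ℤ) (s := s) fun n hn => by rw [qCoeff_eq_zero _ hn, zero_mul],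
      (hasSum_finite_triple_product hq hq0 hw (N + 1)).tsum_eq, qProd_succ' (w⁻¹ * q)]
    ring
  have hl : HasDerivAt (fun w : ℂ => ∑ n ∈ s, qCoeff (q ^ 2) (N + 1) n * (q ^ (n ^ 2) * w ^ n))
      (∑ n ∈ s, qCoeff (q ^ 2) (N + 1) n * (q ^ (n ^ 2) * (n * (-q) ^ (n - 1)))) (-q) :=
    HasDerivAt.fun_sum fun n _ =>
      ((hasDerivAt_zpow n (-q) (Or.inl hq')).const_mul _).const_mul _
  have hd : DifferentiableAt ℂ
      (fun w : ℂ => qProd (w * q) (q ^ 2) (N + 1) * qProd (w⁻¹ * q * q ^ 2) (q ^ 2) N) (-q) := by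
    unfold qProd
    fun_prop (disch := exact hq')
  have hi : HasDerivAt (fun w : ℂ => 1 + w⁻¹ * q) (-((-q) ^ 2)⁻¹ * q) (-q) :=
    ((hasDerivAt_inv hq').mul_const q).const_add 1
  have hr := hd.hasDerivAt.mul hi
  have he := hl.unique (hr.congr_of_eventuallyEq
    ((eventually_ne_nhds hq').mono fun w hw => hsum w hw))
  have h1 : (-q)⁻¹ * q = -1 := by field_simp
  rw [h1, add_neg_cancel, mul_zero, zero_add] at he
  rw [tsum_eq_sum (s := s) fun n hn => by rw [qCoeff_eq_zero _ hn, zero_mul]]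
  have h2 : ∑ n ∈ s, qCoeff (q ^ 2) (N + 1) n * (n * (q ^ (n ^ 2) * (-q) ^ n)) =
      -q * ∑ n ∈ s, qCoeff (q ^ 2) (N + 1) n * (q ^ (n ^ 2) * (n * (-q) ^ (n - 1))) := by
    rw [Finset.mul_sum]
    refine Finset.sum_congr rfl fun n _ => ?_
    rw [zpow_sub_one₀ hq']
    field_simp
  rw [h2, he, show -q * q = -q ^ 2 by ring, show -1 * q ^ 2 = -q ^ 2 by ring]
  field_simp

/-- Jacobi's formula for the cube of the Euler product. -/
theorem tsum_mul_triple_product_neg {q : ℂ} (hq : ‖q‖ < 1) (hq0 : q ≠ 0)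
    (hs : Summable fun n : ℤ => (n : ℂ) * (q ^ (n ^ 2) * (-q) ^ n)) :
    ∑' n : ℤ, (n : ℂ) * (q ^ (n ^ 2) * (-q) ^ n) = qProdInf (-q ^ 2) (q ^ 2) ^ 3 := by
  have hp : ‖q ^ 2‖ < 1 := by rw [norm_pow]; exact pow_lt_one₀ (norm_nonneg _) hq two_ne_zero
  have h0 : qProdInf (-q ^ 2) (q ^ 2) ≠ 0 := qProdInf_ne_zero_of_norm_lt (by simpa using hp) hp
  have h1 := (tendsto_tsum_qCoeff_mul hp hs).comp (tendsto_add_atTop_nat 1)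
  simp only [Function.comp_def, tsum_mul_finite_triple_product_neg hq hq0] at h1
  have h2 := tendsto_nhds_unique h1
    (((tendsto_qProd _ hp).comp (tendsto_add_atTop_nat 1)).mul (tendsto_qProd _ hp))
  rw [pow_succ', sq (qProdInf _ _), ← h2, mul_inv_cancel_left₀ h0]

/-! ### Theta functions: symmetries and derivatives. -/

open Complex in
/-- The theta function `θ[1; 0](z, τ)`, in terms of `jacobiTheta₂`. -/
noncomputable def theta₂ (z τ : ℂ) : ℂ :=
  cexp (Real.pi * I * τ / 4 + Real.pi * I * z) * jacobiTheta₂ (z + τ / 2) τ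

section
open Complex
local notation "π" => (Real.pi : ℂ)

lemma thetaChar_zero_eq (ε' : ℝ) (ζ : ℂ) (τ : UpperHalfPlane) :
    thetaChar 0 ε' ζ τ = jacobiTheta₂ (ζ + ε' / 2) τ := by
  refine tsum_congr fun n => ?_
  rw [jacobiTheta₂_term]
  congr 1
  push_cast
  ring

lemma thetaChar_one_eq (ε' : ℝ) (ζ : ℂ) (τ : UpperHalfPlane) :
    thetaChar 1 ε' ζ τ = theta₂ (ζ + ε' / 2) τ := by
  rw [theta₂, jacobiTheta₂, ← tsum_mul_left]
  refine tsum_congr fun n => ?_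
  rw [jacobiTheta₂_term, ← Complex.exp_add]
  congr 1
  push_cast
  ring

lemma theta₂_neg (z τ : ℂ) : theta₂ (-z) τ = theta₂ z τ := by
  have h := jacobiTheta₂_add_left' (z - τ / 2) τ
  rw [show z - τ / 2 + τ = z + τ / 2 by ring] at h
  rw [theta₂, theta₂, h, ← jacobiTheta₂_neg_left (-z + τ / 2), ← mul_assoc, ← Complex.exp_add,
    show -(-z + τ / 2) = z - τ / 2 by ring]
  congr 2
  ring

lemma theta₂_add_one (z τ : ℂ) : theta₂ (z + 1) τ = -theta₂ z τ := by
  rw [theta₂, theta₂, show z + 1 + τ / 2 = z + τ / 2 + 1 by ring, jacobiTheta₂_add_left,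
    show π * I * τ / 4 + π * I * (z + 1) = π * I * τ / 4 + π * I * z + π * I by ring,
    Complex.exp_add _ (π * I), Complex.exp_pi_mul_I]
  ring

lemma theta₂_one_sub (z τ : ℂ) : theta₂ (1 - z) τ = -theta₂ z τ := by
  rw [← theta₂_neg z, ← theta₂_add_one]
  congr 1
  ring

lemma jacobiTheta₂_one_sub (z τ : ℂ) : jacobiTheta₂ (1 - z) τ = jacobiTheta₂ z τ := by
  rw [← jacobiTheta₂_neg_left z, ← jacobiTheta₂_add_left (-z)]
  congr 1
  ring

lemma theta₂_half (τ : ℂ) : theta₂ (1 / 2) τ = 0 := by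
  have h := theta₂_one_sub (1 / 2) τ
  norm_num at h
  exact self_eq_neg.1 (by norm_num; exact h)

/-- The derivative is odd and 1-periodic. -/
lemma jacobiTheta₂'_half (τ : ℂ) : jacobiTheta₂' (1 / 2) τ = 0 := by
  have h := jacobiTheta₂'_add_left (-(1 / 2)) τ
  rw [jacobiTheta₂'_neg_left, show -(1 / 2 : ℂ) + 1 = 1 / 2 by norm_num] at h
  exact self_eq_neg.1 h

lemma hasDerivAt_theta₂ (z : ℂ) {τ : ℂ} (hτ : 0 < im τ) :
    HasDerivAt (theta₂ · τ) (π * I * theta₂ z τ +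
      cexp (π * I * τ / 4 + π * I * z) * jacobiTheta₂' (z + τ / 2) τ) z := by
  have h1 : HasDerivAt (fun z : ℂ => cexp (π * I * τ / 4 + π * I * z))
      (cexp (π * I * τ / 4 + π * I * z) * (π * I)) z := by
    simpa using (((hasDerivAt_id z).const_mul (π * I)).const_add (π * I * τ / 4)).cexp
  have h2 : HasDerivAt (fun z : ℂ => jacobiTheta₂ (z + τ / 2) τ)
      (jacobiTheta₂' (z + τ / 2) τ) z :=
    (hasDerivAt_jacobiTheta₂_fst (z + τ / 2) hτ).comp_add_const z (τ / 2)
  refine (h1.mul h2).congr_deriv ?_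
  rw [theta₂]
  ring

/-! ### Duplication formulas. -/

/-- The bijection behind `n² + m² = 2a² + 2b²` or `2(a + 1/2)² + 2(b + 1/2)²`, according to the
parity of `n + m`. -/
def intProdParityEquiv : (ℤ × ℤ) ⊕ (ℤ × ℤ) ≃ ℤ × ℤ where
  toFun := Sum.elim (fun x => (x.1 + x.2, x.1 - x.2)) (fun x => (x.1 + x.2 + 1, x.1 - x.2))
  invFun y := if (y.1 + y.2) % 2 = 0 then Sum.inl ((y.1 + y.2) / 2, (y.1 - y.2) / 2)
    else Sum.inr ((y.1 + y.2 - 1) / 2, (y.1 - y.2 - 1) / 2)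
  left_inv := by
    rintro (⟨a, b⟩ | ⟨a, b⟩)
    · change (if (a + b + (a - b)) % 2 = 0 then (Sum.inl ((a + b + (a - b)) / 2,
        (a + b - (a - b)) / 2) : (ℤ × ℤ) ⊕ (ℤ × ℤ)) else _) = _
      rw [if_pos (by omega)]
      congr 2 <;> omega
    · change (if (a + b + 1 + (a - b)) % 2 = 0 then _ else (Sum.inr ((a + b + 1 + (a - b) - 1) / 2,
        (a + b + 1 - (a - b) - 1) / 2) : (ℤ × ℤ) ⊕ (ℤ × ℤ))) = _
      rw [if_neg (by omega)]
      congr 2 <;> omega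
  right_inv := by
    rintro ⟨n, m⟩
    simp only
    split_ifs
    · simp only [Sum.elim_inl, Prod.mk.injEq]; omega
    · simp only [Sum.elim_inr, Prod.mk.injEq]; omega

lemma hasSum_jacobiTheta₂_term_mul (z w : ℂ) {τ : ℂ} (hτ : 0 < im τ) :
    HasSum (fun x : ℤ × ℤ => jacobiTheta₂_term x.1 z τ * jacobiTheta₂_term x.2 w τ)
      (jacobiTheta₂ z τ * jacobiTheta₂ w τ) := by
  have h1 := hasSum_jacobiTheta₂_term z hτ
  have h2 := hasSum_jacobiTheta₂_term w hτ
  have h3 : Summable fun x : ℤ × ℤ => jacobiTheta₂_term x.1 z τ * jacobiTheta₂_term x.2 w τ :=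
    summable_mul_of_summable_norm (f := fun n : ℤ => jacobiTheta₂_term n z τ)
      (g := fun n : ℤ => jacobiTheta₂_term n w τ) h1.summable.norm h2.summable.norm
  exact HasSum.mul (f := fun n : ℤ => jacobiTheta₂_term n z τ)
      (g := fun n : ℤ => jacobiTheta₂_term n w τ) h1 h2 h3

lemma jacobiTheta₂_sq (z : ℂ) {τ : ℂ} (hτ : 0 < im τ) :
    jacobiTheta₂ z τ ^ 2 = jacobiTheta₂ (2 * z) (2 * τ) * jacobiTheta₂ 0 (2 * τ) +
      theta₂ (2 * z) (2 * τ) * theta₂ 0 (2 * τ) := by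
  have hτ2 : 0 < im (2 * τ) := by simpa using hτ
  have h0 := (intProdParityEquiv.hasSum_iff).2 (hasSum_jacobiTheta₂_term_mul z z hτ)
  have h1 := hasSum_jacobiTheta₂_term_mul (2 * z) 0 hτ2
  have h2 := (hasSum_jacobiTheta₂_term_mul (2 * z + 2 * τ / 2) (0 + 2 * τ / 2) hτ2).mul_left
    (cexp (π * I * (2 * τ) / 4 + π * I * (2 * z)) * cexp (π * I * (2 * τ) / 4 + π * I * 0))
  rw [sq]
  refine h0.unique ?_
  rw [show theta₂ (2 * z) (2 * τ) * theta₂ 0 (2 * τ) =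
    (cexp (π * I * (2 * τ) / 4 + π * I * (2 * z)) * cexp (π * I * (2 * τ) / 4 + π * I * 0)) *
    (jacobiTheta₂ (2 * z + 2 * τ / 2) (2 * τ) * jacobiTheta₂ (0 + 2 * τ / 2) (2 * τ)) by
      rw [theta₂, theta₂]; ring]
  refine HasSum.sum ?_ ?_
  · refine HasSum.congr_fun h1 fun x => ?_
    simp only [Function.comp_apply, intProdParityEquiv, Equiv.coe_fn_mk, Sum.elim_inl,
      jacobiTheta₂_term, ← Complex.exp_add]
    congr 1
    push_cast
    ring
  · refine HasSum.congr_fun h2 fun x => ?_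
    simp only [Function.comp_apply, intProdParityEquiv, Equiv.coe_fn_mk, Sum.elim_inr,
      jacobiTheta₂_term, ← Complex.exp_add]
    congr 1
    push_cast
    ring

/-- The shift of `z` by `τ / 2` turns `jacobiTheta₂_sq` into this: it exchanges the two theta
functions up to exponential factors, which cancel. -/
lemma theta₂_sq (z : ℂ) {τ : ℂ} (hτ : 0 < im τ) :
    theta₂ z τ ^ 2 = theta₂ (2 * z) (2 * τ) * jacobiTheta₂ 0 (2 * τ) +
      jacobiTheta₂ (2 * z) (2 * τ) * theta₂ 0 (2 * τ) := by
  have h := jacobiTheta₂_add_left' (2 * z) (2 * τ)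
  have e1 : theta₂ (2 * (z + τ / 2)) (2 * τ) =
      cexp (-(π * I * τ / 2 + 2 * π * I * z)) * jacobiTheta₂ (2 * z) (2 * τ) := by
    rw [theta₂, show 2 * (z + τ / 2) + 2 * τ / 2 = 2 * z + 2 * τ by ring, h, ← mul_assoc,
      ← Complex.exp_add]
    congr 2
    ring
  have e2 : theta₂ (2 * z) (2 * τ) = cexp (π * I * τ / 2 + 2 * π * I * z) *
      jacobiTheta₂ (2 * (z + τ / 2)) (2 * τ) := by
    rw [theta₂]
    congr 2 <;> ring
  have e3 : cexp (π * I * τ / 4 + π * I * z) ^ 2 = cexp (π * I * τ / 2 + 2 * π * I * z) := by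
    rw [← Complex.exp_nat_mul]
    congr 1
    push_cast
    ring
  rw [e2, theta₂, mul_pow, e3, jacobiTheta₂_sq _ hτ, e1, Complex.exp_neg]
  have := Complex.exp_ne_zero (π * I * τ / 2 + 2 * π * I * z)
  field_simp

/-- Replacing `z` by `1/2 - z` flips the sign of `θ₂(2z, 2τ)` only, so the cross terms of the
squared duplication formulas cancel in the sum. -/
lemma theta₂_pow_four_add (z : ℂ) {τ : ℂ} (hτ : 0 < im τ) :
    theta₂ z τ ^ 4 + theta₂ (1 / 2 - z) τ ^ 4 =
      2 * (jacobiTheta₂ 0 (4 * τ) * (jacobiTheta₂ 0 (4 * τ) ^ 2 + 3 * theta₂ 0 (4 * τ) ^ 2)) *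
        theta₂ (4 * z) (4 * τ) +
      2 * (theta₂ 0 (4 * τ) * (3 * jacobiTheta₂ 0 (4 * τ) ^ 2 + theta₂ 0 (4 * τ) ^ 2)) *
        jacobiTheta₂ (4 * z) (4 * τ) := by
  have hτ2 : 0 < im (2 * τ) := by simpa using hτ
  have h1 := theta₂_sq z hτ
  have h2 := theta₂_sq (1 / 2 - z) hτ
  rw [show 2 * (1 / 2 - z) = 1 - 2 * z by ring, theta₂_one_sub, jacobiTheta₂_one_sub] at h2
  have h3 := theta₂_sq (2 * z) hτ2
  have h4 := jacobiTheta₂_sq (2 * z) hτ2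
  have h5 := theta₂_sq 0 hτ2
  have h6 := jacobiTheta₂_sq 0 hτ2
  rw [mul_zero] at h5 h6
  simp only [← mul_assoc] at h3 h4 h5 h6
  norm_num at h3 h4 h5 h6
  calc theta₂ z τ ^ 4 + theta₂ (1 / 2 - z) τ ^ 4
      = (theta₂ z τ ^ 2) ^ 2 + (theta₂ (1 / 2 - z) τ ^ 2) ^ 2 := by ring
    _ = 2 * (theta₂ (2 * z) (2 * τ) ^ 2 * jacobiTheta₂ 0 (2 * τ) ^ 2 +
        jacobiTheta₂ (2 * z) (2 * τ) ^ 2 * theta₂ 0 (2 * τ) ^ 2) := by rw [h1, h2]; ring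
    _ = _ := by rw [h3, h4, h5, h6]; ring

/-! ### Product formulas, nonvanishing and Jacobi's derivative formula. -/

lemma norm_nome_lt_one {τ : ℂ} (hτ : 0 < im τ) : ‖cexp (π * I * τ)‖ < 1 := by
  rw [Complex.norm_exp, Real.exp_lt_one_iff]
  simpa using mul_pos Real.pi_pos hτ

lemma jacobiTheta₂_term_eq (n : ℤ) (z τ : ℂ) : jacobiTheta₂_term n z τ =
    cexp (π * I * τ) ^ (n ^ 2) * cexp (2 * π * I * z) ^ n := by
  rw [← Complex.exp_int_mul, ← Complex.exp_int_mul, ← Complex.exp_add, jacobiTheta₂_term]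
  congr 1
  push_cast
  ring

/-- The product formula for `jacobiTheta₂`. -/
lemma jacobiTheta₂_eq_prod (z : ℂ) {τ q w : ℂ} (hτ : 0 < im τ) (hq : q = cexp (π * I * τ))
    (hw : w = cexp (2 * π * I * z)) : jacobiTheta₂ z τ =
      qProdInf (-q ^ 2) (q ^ 2) * (qProdInf (w * q) (q ^ 2) * qProdInf (w⁻¹ * q) (q ^ 2)) := by
  subst hq hw
  rw [← tsum_triple_product (norm_nome_lt_one hτ) (Complex.exp_ne_zero _) (Complex.exp_ne_zero _)]
  · simp only [jacobiTheta₂, jacobiTheta₂_term_eq]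
  · simpa only [jacobiTheta₂_term_eq] using (hasSum_jacobiTheta₂_term z hτ).summable

/-- The product formula for `theta₂`. -/
lemma theta₂_eq_prod (z : ℂ) {τ q w : ℂ} (hτ : 0 < im τ) (hq : q = cexp (π * I * τ))
    (hw : w = cexp (2 * π * I * z)) : theta₂ z τ = cexp (π * I * τ / 4 + π * I * z) *
      (qProdInf (-q ^ 2) (q ^ 2) *
        (qProdInf (w * q ^ 2) (q ^ 2) * ((1 + w⁻¹) * qProdInf (w⁻¹ * q ^ 2) (q ^ 2)))) := by
  have hq1 : ‖q‖ < 1 := hq ▸ norm_nome_lt_one hτ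
  have hp : ‖q ^ 2‖ < 1 := by rw [norm_pow]; exact pow_lt_one₀ (norm_nonneg _) hq1 two_ne_zero
  have hq0 : q ≠ 0 := hq ▸ Complex.exp_ne_zero _
  have hw' : w * q = cexp (2 * π * I * (z + τ / 2)) := by
    rw [hw, hq, ← Complex.exp_add]
    congr 1
    ring
  rw [theta₂, jacobiTheta₂_eq_prod _ hτ hq hw', ← qProdInf_eq_one_add_mul _ hp, mul_inv,
    inv_mul_cancel_right₀ hq0, mul_assoc w, ← sq]

/-- For real `x`, `w = exp(2πix)` has norm 1, so only the factor `1 + w⁻¹` could vanish. -/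
lemma theta₂_ne_zero {x : ℝ} {τ : ℂ} (hτ : 0 < im τ) (hx : cexp (2 * π * I * x) ≠ -1) :
    theta₂ x τ ≠ 0 := by
  have hq1 := norm_nome_lt_one hτ
  have hp : ‖cexp (π * I * τ) ^ 2‖ < 1 := by
    rw [norm_pow]; exact pow_lt_one₀ (norm_nonneg _) hq1 two_ne_zero
  have hw : ‖cexp (2 * π * I * x)‖ = 1 := by simp [Complex.norm_exp]
  rw [theta₂_eq_prod x hτ rfl rfl]
  refine mul_ne_zero (Complex.exp_ne_zero _) (mul_ne_zero ?_ (mul_ne_zero ?_ (mul_ne_zero ?_ ?_)))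
  · exact qProdInf_ne_zero_of_norm_lt (by rwa [norm_neg]) hp
  · exact qProdInf_ne_zero_of_norm_lt (by rwa [norm_mul, hw, one_mul]) hp
  · intro h
    exact hx (inv_eq_iff_eq_inv.1 (eq_neg_of_add_eq_zero_right h) |>.trans (by norm_num))
  · exact qProdInf_ne_zero_of_norm_lt (by rwa [norm_mul, norm_inv, hw, inv_one, one_mul]) hp

/-- Jacobi's derivative formula `θ₁' = π θ₂ θ₃ θ₄`. -/
lemma hasDerivAt_theta₂_half {τ : ℂ} (hτ : 0 < im τ) :
    HasDerivAt (theta₂ · τ) (-π * (jacobiTheta₂ 0 τ * theta₂ 0 τ * jacobiTheta₂ (1 / 2) τ))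
      (1 / 2) := by
  have hq1 := norm_nome_lt_one hτ
  set q := cexp (π * I * τ) with hq
  have hw : (-q) = cexp (2 * π * I * (1 / 2 + τ / 2)) := by
    rw [show 2 * π * I * (1 / 2 + τ / 2) = π * I * τ + π * I by ring, Complex.exp_add,
      Complex.exp_pi_mul_I, hq]
    ring
  have hs := (hasSum_jacobiTheta₂'_term (1 / 2 + τ / 2) hτ).summable
  have hpi : (2 * π * I) ≠ 0 := Complex.two_pi_I_ne_zero
  simp only [jacobiTheta₂'_term, jacobiTheta₂_term_eq, ← hw, ← hq, mul_assoc (2 * π * I)] at hs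
  have hd : jacobiTheta₂' (1 / 2 + τ / 2) τ = 2 * π * I * qProdInf (-q ^ 2) (q ^ 2) ^ 3 := by
    rw [← tsum_mul_triple_product_neg hq1 (Complex.exp_ne_zero _)
      ((summable_mul_left_iff hpi).1 hs), ← tsum_mul_left]
    simp only [jacobiTheta₂', jacobiTheta₂'_term, jacobiTheta₂_term_eq, ← hw, ← hq,
      mul_assoc (2 * π * I)]
  refine (hasDerivAt_theta₂ (1 / 2) hτ).congr_deriv ?_
  have hone : (1 : ℂ) = cexp (2 * π * I * 0) := by simp
  have hneg : (-1 : ℂ) = cexp (2 * π * I * (1 / 2)) := by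
    rw [show 2 * π * I * (1 / 2) = π * I by ring, Complex.exp_pi_mul_I]
  rw [theta₂_half, hd, jacobiTheta₂_eq_prod 0 hτ hq hone, theta₂_eq_prod 0 hτ hq hone,
    jacobiTheta₂_eq_prod (1 / 2) hτ hq hneg, Complex.exp_add,
    show π * I * (1 / 2) = π / 2 * I by ring, Complex.exp_pi_div_two_mul_I]
  have he := qProdInf_euler hq1
  simp only [mul_zero, add_zero, zero_add, inv_one, one_mul, inv_neg, neg_mul]
  have hI := Complex.I_sq
  -- Euler's product `E` enters squared, and `E² - 1 = (E + 1)(E - 1)`.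
  linear_combination (2 * π * cexp (π * I * τ / 4) * qProdInf (-q ^ 2) (q ^ 2) ^ 3) * hI +
    (2 * π * cexp (π * I * τ / 4) * qProdInf (-q ^ 2) (q ^ 2) ^ 3 *
      (qProdInf (q ^ 2) (q ^ 2) * qProdInf q (q ^ 2) * qProdInf (-q) (q ^ 2) + 1)) * he

end

/-! ### The identity, by differentiation at `1/8`. -/

theorem mainTheorem9 (τ : UpperHalfPlane) :
    thetaConst 1 (1 / 4) τ ≠ 0 ∧ thetaConst 1 (3 / 4) τ ≠ 0 ∧
    thetaConst 1 (1 / 4) τ ^ 4 * (thetaDerivConst 1 (1 / 4) τ / thetaConst 1 (1 / 4) τ) -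
        thetaConst 1 (3 / 4) τ ^ 4 * (thetaDerivConst 1 (3 / 4) τ / thetaConst 1 (3 / 4) τ) =
      -2 * (Real.pi : ℂ) * thetaConst 0 0 (fourMul τ) ^ 2 * thetaConst 1 0 (fourMul τ) *
        thetaConst 0 1 (fourMul τ) *
        (thetaConst 0 0 (fourMul τ) ^ 2 + 3 * thetaConst 1 0 (fourMul τ) ^ 2) := by
  have hτ : 0 < (τ : ℂ).im := τ.im_pos
  have hτ4 : 0 < (4 * (τ : ℂ)).im := by simpa using hτ
  have hfour : ((fourMul τ : UpperHalfPlane) : ℂ) = 4 * τ := rfl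
  have hA : thetaConst 1 (1 / 4) τ = theta₂ (1 / 8) τ := by
    rw [thetaConst, thetaChar_one_eq]; push_cast; norm_num
  have hB : thetaConst 1 (3 / 4) τ = theta₂ (3 / 8) τ := by
    rw [thetaConst, thetaChar_one_eq]; push_cast; norm_num
  have h3 : thetaConst 0 0 (fourMul τ) = jacobiTheta₂ 0 (4 * τ) := by
    rw [thetaConst, thetaChar_zero_eq, hfour]; norm_num
  have h2 : thetaConst 1 0 (fourMul τ) = theta₂ 0 (4 * τ) := by
    rw [thetaConst, thetaChar_one_eq, hfour]; norm_num
  have h4 : thetaConst 0 1 (fourMul τ) = jacobiTheta₂ (1 / 2) (4 * τ) := by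
    rw [thetaConst, thetaChar_zero_eq, hfour]; norm_num
  have hd (z : ℂ) : HasDerivAt (theta₂ · (τ : ℂ)) (deriv (theta₂ · (τ : ℂ)) z) z :=
    (hasDerivAt_theta₂ z hτ).differentiableAt.hasDerivAt
  have hD (ε' : ℝ) : thetaDerivConst 1 ε' τ = deriv (theta₂ · (τ : ℂ)) (ε' / 2) := by
    simp only [thetaDerivConst, thetaChar_one_eq]
    rw [deriv_comp_add_const (theta₂ · (τ : ℂ)), zero_add]
  have hA' : thetaDerivConst 1 (1 / 4) τ = deriv (theta₂ · (τ : ℂ)) (1 / 8) := by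
    rw [hD]; push_cast; norm_num
  have hB' : thetaDerivConst 1 (3 / 4) τ = deriv (theta₂ · (τ : ℂ)) (3 / 8) := by
    rw [hD]; push_cast; norm_num
  have hA0 : theta₂ (1 / 8) τ ≠ 0 := by
    have := theta₂_ne_zero (x := 1 / 8) hτ fun h => by
      -- The fourth power of `exp(2πi/8)` is `-1`, whereas `(-1)^4 = 1`.
      have h' := congrArg (· ^ 4) h
      simp only [← Complex.exp_nat_mul] at h'
      rw [show ((4 : ℕ) : ℂ) * (2 * Real.pi * Complex.I * ((1 / 8 : ℝ) : ℂ)) =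
        Real.pi * Complex.I by push_cast; ring, Complex.exp_pi_mul_I] at h'
      norm_num at h'
    simpa using this
  have hB0 : theta₂ (3 / 8) τ ≠ 0 := by
    have := theta₂_ne_zero (x := 3 / 8) hτ fun h => by
      have h' := congrArg (· ^ 4) h
      simp only [← Complex.exp_nat_mul] at h'
      rw [show ((4 : ℕ) : ℂ) * (2 * Real.pi * Complex.I * ((3 / 8 : ℝ) : ℂ)) =
        Real.pi * Complex.I + 2 * Real.pi * Complex.I by push_cast; ring, Complex.exp_add,
        Complex.exp_pi_mul_I, Complex.exp_two_pi_mul_I] at h'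
      norm_num at h'
    simpa using this
  rw [hA, hB, hA', hB', h2, h3, h4]
  refine ⟨hA0, hB0, ?_⟩
  have hl1 := (hd (1 / 8)).pow 4
  have hl2 : HasDerivAt (fun z : ℂ => theta₂ (1 / 2 - z) τ ^ 4)
      (4 * theta₂ (3 / 8) τ ^ 3 * -deriv (theta₂ · (τ : ℂ)) (3 / 8)) (1 / 8) := by
    have h := hd (1 / 2 - 1 / 8)
    rw [show (1 / 2 - 1 / 8 : ℂ) = 3 / 8 by norm_num] at h
    have h' := HasDerivAt.comp_const_sub (1 / 2 : ℂ) (1 / 8)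
      (by rwa [show (1 / 2 - 1 / 8 : ℂ) = 3 / 8 by norm_num])
    refine (h'.pow 4).congr_deriv ?_
    norm_num
  have h14 : (4 * (1 / 8) : ℂ) = 1 / 2 := by norm_num
  have hmul (f : ℂ → ℂ) {f' : ℂ} (hf : HasDerivAt f f' (1 / 2)) :
      HasDerivAt (fun z => f (4 * z)) (f' * 4) (1 / 8) := by
    rw [← h14] at hf
    refine HasDerivAt.comp (1 / 8 : ℂ) hf ?_
    simpa using (hasDerivAt_id (1 / 8 : ℂ)).const_mul 4
  have hr1 := hmul _ (hasDerivAt_theta₂_half hτ4)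
  have hr2 := hmul _ (hasDerivAt_jacobiTheta₂_fst (1 / 2) hτ4)
  have hr := (hr1.const_mul (2 * (jacobiTheta₂ 0 (4 * τ) *
    (jacobiTheta₂ 0 (4 * τ) ^ 2 + 3 * theta₂ 0 (4 * τ) ^ 2)))).add
    (hr2.const_mul (2 * (theta₂ 0 (4 * τ) *
      (3 * jacobiTheta₂ 0 (4 * τ) ^ 2 + theta₂ 0 (4 * τ) ^ 2))))
  have he := (hl1.add hl2).unique (hr.congr_of_eventuallyEq
    (Filter.Eventually.of_forall fun z => theta₂_pow_four_add z hτ))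
  rw [jacobiTheta₂'_half] at he
  push_cast at he
  have e1 : theta₂ (1 / 8) τ ^ 4 * (deriv (theta₂ · (τ : ℂ)) (1 / 8) / theta₂ (1 / 8) τ) =
      theta₂ (1 / 8) τ ^ 3 * deriv (theta₂ · (τ : ℂ)) (1 / 8) := by field_simp
  have e2 : theta₂ (3 / 8) τ ^ 4 * (deriv (theta₂ · (τ : ℂ)) (3 / 8) / theta₂ (3 / 8) τ) =
      theta₂ (3 / 8) τ ^ 3 * deriv (theta₂ · (τ : ℂ)) (3 / 8) := by field_simp
  rw [e1, e2]
  -- The fourth powers on the left and the inner `4z` on the right each contribute a factor 4.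
  linear_combination (1 / 4) * he
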